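/- **Setting.** Let $N\ge 1$ be an integer, $k\in\frac12\mathbb Z$ (with $4\mid N$ if $k\notin\mathbb Z$) and $\chi$ a Dirichlet character mod $N$. Powers $z^{a}$ are taken with the principal branch. Let $H_k(N,\chi)$ be the space of harmonic Maass forms: smooth $f:\mathbb H\to\mathbb C$ such that 1. $f|_k\gamma=\chi(d)f$ for all $\gamma=\left(\begin{smallmatrix}a&b\\c&d\end{smallmatrix}\right)\in\Gamma_0(N)$, where $(f|_k\gamma)(z)=(cz+d)^{-k}f(\gamma z)$, multiplied by $\left(\frac cd\right)\varepsilon_d^{2k}$ if $k\notin\mathbb Z$ (here $\left(\frac cd\right)$ is the Kronecker symbol, and $\varepsilon_d=1$ or $i$ according as $d\equiv1$ or $3 \bmod 4$); 2. $\Delta_kf=0$, where $\Delta_k=-y^2\left(\frac{\partial^2}{\partial x^2}+\frac{\partial^2}{\partial y^2}\right)+iky\left(\frac{\partial}{\partial x}+i\frac{\partial}{\partial y}\right)$; 3. for each $\sigma=\left(\begin{smallmatrix}a&b\\c&d\end{smallmatrix}\right)\in \mathrm{SL}_2(\mathbb Z)$ there are an integer $h\ge1$, a polynomial $P$ and $\varepsilon>0$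 with $(cz+d)^{-k}f(\sigma z)-P(e^{-2\pi i z/h})=O(e^{-\varepsilon y})$ as $y=\operatorname{Im} z\to\infty$. Let $\Gamma(a,x)=\int_x^\infty t^{a-1}e^{-t}\,dt$ for $x>0$. Let $f\in H_k(N,\chi)$ have the Fourier expansion $$f(z)=\sum_{n\ge -n_0}c^+(n)e^{2\pi i nz}+\sum_{n\ge1}c^-(n)\Gamma(1-k,4\pi ny)e^{-2\pi i nz},$$ with both series convergent absolutely for each $z\in\mathbb H$, and let $g(z)=(f|_kw_N)(z)=N^{k/2}(Nz)^{-k}f(-1/(Nz))$ have the expansion of the same kind with coefficients $d^{+}(n)$ ($n\ge -m_0$) and $d^-(n)$ ($n\ge1$), where $n_0,m_0\ge0$ are integers. For $\varphi:\mathbb R_+\to\mathbb C$ put $\varphi_s(x)=\varphi(x)x^{s-1}$, $(\varphi|_aw_N)(x)=(Nx)^{-a}\varphi(1/(Nx))$ and $(\mathcal L\varphi)(s)=\int_0^\infty\varphi(x)e^{-sx}dx$. Let $\mathcal F_f$ be the set of continuous $\varphi:\mathbb R_+\to\mathbb C$ such that $(\mathcal L\varphi)(s)$ converges absolutely for $\operatorname{Re}s\ge-2\pi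 n_0$, $(\mathcal L\varphi_{2-k})(s)$ converges absolutely for $\operatorname{Re}s>0$, and $$\sum_{n\ge-n_0}|c^+(n)|(\mathcal L|\varphi|)(2\pi n)+\sum_{n>0}|c^-(n)|(4\pi n)^{1-k}\int_0^\infty\frac{(\mathcal L|\varphi_{2-k}|)(2\pi n(2t+1))}{(1+t)^k}dt<\infty ;$$ for $\varphi\in\mathcal F_f$ set $$L_f(\varphi)=\sum_{n\ge-n_0}c^+(n)(\mathcal L\varphi)(2\pi n)+\sum_{n>0}c^-(n)(4\pi n)^{1-k}\int_0^\infty\frac{(\mathcal L\varphi_{2-k})(2\pi n(2t+1))}{(1+t)^k}dt .$$ Define $\mathcal F_g$ and $L_g$ in the same way from $d^{\pm}(n)$ and $m_0$. **Proposition.** Let $F:\mathbb R_+\to\mathbb C$ be continuous, such that the Mellin transform $\mathcal M(F)(s)=\int_0^\infty F(x)x^{s-1}dx$ converges absolutely (hence uniformly on compacta) in $\operatorname{Re}s<0$ and is absolutely integrable on each line $-\varepsilon+i\mathbb R$, $\varepsilon>0$. Let $\varphi:\mathbb R_+\to\mathbb C$ be continuous, such that for all $s\in\mathbb C$ we have $\varphi_s\in\mathcal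 F_f$ and $\varphi_s|_{2-k}w_N\in\mathcal F_g$, and such that $L_f(\varphi_s)$ and $L_g(\varphi_s|_{2-k}w_N)$ are entire functions of $s$. Then all the integrals and series below converge absolutely, and $$\sum_{n\ge-n_0}c^+(n)\int_0^\infty F(x)\varphi(x)e^{-2\pi nx}\frac{dx}x+\sum_{n>0}c^-(n)\int_0^\infty F(x)\varphi(x)e^{2\pi nx}\Gamma(1-k,4\pi nx)\frac{dx}x$$ $$=i^kN^{-k/2}\left(\sum_{n\ge-m_0}d^+(n)\int_0^\infty F(x)\varphi(x)x^{-1-k}e^{-\frac{2\pi n}{Nx}}dx+\sum_{n>0}d^-(n)\int_0^\infty F(x)\varphi(x)x^{-1-k}e^{\frac{2\pi n}{Nx}}\Gamma\!\left(1-k,\frac{4\pi n}{Nx}\right)dx\right).$$ -/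

import Mathlib

open MeasureTheory Set Filter
open scoped ENNReal UpperHalfPlane MatrixGroups

noncomputable section

namespace HMF

/-! ### Slash operators -/

/-- The Kronecker symbol `(c/d)` for odd `d` (only odd `d` occur, as lower right entries of
matrices in `Γ₀(4)`): the Jacobi symbol `(c/|d|)`, times `-1` if both `c` and `d` are negative. -/
def kronecker (c d : ℤ) : ℤ :=
  (if c < 0 ∧ d < 0 then -1 else 1) * jacobiSym c d.natAbs

/-- `ε_d = 1` if `d ≡ 1 mod 4`, `ε_d = i` if `d ≡ 3 mod 4`. -/
def epsilon (d : ℤ) : ℂ :=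
  if d % 4 = 1 then 1 else Complex.I

/-- The function `z ↦ (c z + d)^(-k) f(γ z)`, with the principal branch of the power. -/
def plainSlash (k : ℝ) (f : ℍ → ℂ) (γ : SL(2, ℤ)) : ℍ → ℂ := fun z =>
  (((γ 1 0 : ℤ) : ℂ) * (z : ℂ) + ((γ 1 1 : ℤ) : ℂ)) ^ (-(k : ℂ)) * f (γ • z)

open Classical in
/-- The Petersson slash operator `f|_k γ`: for integral `k` it is `(c z + d)^(-k) f(γ z)`, and for
`k ∈ 1/2 + ℤ` (and `γ ∈ Γ₀(4)`) it is `(c/d) ε_d^(2k) (c z + d)^(-k) f(γ z)`. -/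
def slash (k : ℝ) (f : ℍ → ℂ) (γ : SL(2, ℤ)) : ℍ → ℂ := fun z =>
  if ∃ m : ℤ, k = m then plainSlash k f γ z
  else (kronecker (γ 1 0) (γ 1 1) : ℂ) * epsilon (γ 1 1) ^ (2 * (k : ℂ)) * plainSlash k f γ z

/-- `(f|_k w_N)(z) = N^(k/2) (N z)^(-k) f(-1/(N z))`. -/
def fricke (N : ℕ) (k : ℝ) (f : ℍ → ℂ) : ℍ → ℂ := fun z =>
  (N : ℂ) ^ ((k : ℂ) / 2) * ((N : ℂ) * (z : ℂ)) ^ (-(k : ℂ)) *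
    f (UpperHalfPlane.ofComplex (-1 / ((N : ℂ) * (z : ℂ))))

/-! ### Harmonic Maass forms -/

/-- The weight `k` hyperbolic Laplacian
`Δ_k = -y² (∂²/∂x² + ∂²/∂y²) + i k y (∂/∂x + i ∂/∂y)`. -/
def hyperbolicLaplacian (k : ℝ) (f : ℍ → ℂ) : ℍ → ℂ := fun z =>
  -((z.im : ℂ) ^ 2) * Laplacian.laplacian (f ∘ UpperHalfPlane.ofComplex : ℂ → ℂ) (z : ℂ) +
    Complex.I * (k : ℂ) * (z.im : ℂ) *
      (fderiv ℝ (f ∘ UpperHalfPlane.ofComplex) (z : ℂ) 1 +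
        Complex.I * fderiv ℝ (f ∘ UpperHalfPlane.ofComplex) (z : ℂ) Complex.I)

/-- The space `H_k(N, χ)` of harmonic Maass forms of weight `k` and character `χ` on `Γ₀(N)`.
In the growth condition `h` plays the role of the width of the cusp `σ ∞`, so that `P` is a
polynomial in `q^(-1/h)`; the constant of modulus one by which `plainSlash` can differ from `slash`
does not matter there. -/
structure IsHarmonicMaassForm (N : ℕ) (k : ℝ) (χ : DirichletCharacter ℂ N) (f : ℍ → ℂ) :
    Prop where
  smooth : ContDiffOn ℝ ((⊤ : ℕ∞) : WithTop ℕ∞) (f ∘ UpperHalfPlane.ofComplex) {z : ℂ | 0 < z.im}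
  transform : ∀ γ ∈ CongruenceSubgroup.Gamma0 N, ∀ z : ℍ,
    slash k f γ z = χ ((γ 1 1 : ℤ) : ZMod N) * f z
  harmonic : ∀ z : ℍ, hyperbolicLaplacian k f z = 0
  growth : ∀ σ : SL(2, ℤ), ∃ h : ℕ, 0 < h ∧ ∃ P : Polynomial ℂ, ∃ ε : ℝ, 0 < ε ∧
    (fun z : ℍ => plainSlash k f σ z -
        P.eval (Complex.exp (-(2 * Real.pi * Complex.I * (z : ℂ) / (h : ℂ)))))
      =O[UpperHalfPlane.atImInfty] fun z : ℍ => Real.exp (-ε * z.im)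

/-- The incomplete Gamma function `Γ(a, x) = ∫_x^∞ t^(a-1) e^(-t) dt`, for `x > 0`. -/
def incGamma (a x : ℝ) : ℝ :=
  ∫ t in Ioi x, t ^ (a - 1) * Real.exp (-t)

/-- `c⁺(n)` (`n ≥ -n₀`) and `c⁻(n)` (`n ≥ 1`) are the Fourier coefficients of `f` in weight `k`:
`f(z) = ∑_{n ≥ -n₀} c⁺(n) q^n + ∑_{n ≥ 1} c⁻(n) Γ(1-k, 4πny) q^(-n)`, `q = e^(2πiz)`, `y = Im z`. -/
def HasFourierExpansion (k : ℝ) (f : ℍ → ℂ) (n₀ : ℕ) (cp : ℤ → ℂ) (cm : ℕ+ → ℂ) : Prop :=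
  ∀ z : ℍ,
    Summable (fun n : Ici (-(n₀ : ℤ)) =>
      cp n * Complex.exp (2 * Real.pi * Complex.I * ((n : ℤ) : ℂ) * (z : ℂ))) ∧
    Summable (fun n : ℕ+ => cm n * (incGamma (1 - k) (4 * Real.pi * (n : ℝ) * z.im) : ℂ) *
      Complex.exp (-(2 * Real.pi * Complex.I * ((n : ℕ) : ℂ) * (z : ℂ)))) ∧
    f z = (∑' n : Ici (-(n₀ : ℤ)),
        cp n * Complex.exp (2 * Real.pi * Complex.I * ((n : ℤ) : ℂ) * (z : ℂ))) +
      ∑' n : ℕ+, cm n * (incGamma (1 - k) (4 * Real.pi * (n : ℝ) * z.im) : ℂ) *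
        Complex.exp (-(2 * Real.pi * Complex.I * ((n : ℕ) : ℂ) * (z : ℂ)))

/-! ### Test functions and L-series

Functions on `ℝ₊` are functions on `ℝ` of which only the values on `(0, ∞)` matter. -/

/-- `φ_s(x) = φ(x) x^(s-1)`. -/
def twist (φ : ℝ → ℂ) (s : ℂ) : ℝ → ℂ := fun x => φ x * (x : ℂ) ^ (s - 1)

/-- `(φ|_a w_N)(x) = (N x)^(-a) φ(1/(N x))`. -/
def testFricke (N : ℕ) (a : ℝ) (φ : ℝ → ℂ) : ℝ → ℂ := fun x =>
  ((((N : ℝ) * x) ^ (-a) : ℝ) : ℂ) * φ (1 / ((N : ℝ) * x))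

/-- Absolute convergence of the Laplace integral of `φ` at `s`. -/
def LaplaceConvergent (φ : ℝ → ℂ) (s : ℂ) : Prop :=
  IntegrableOn (fun x : ℝ => φ x * Complex.exp (-s * (x : ℂ))) (Ioi 0)

/-- The Laplace transform `(ℒφ)(s) = ∫_0^∞ φ(x) e^(-sx) dx`. -/
def laplace (φ : ℝ → ℂ) (s : ℂ) : ℂ :=
  ∫ x in Ioi (0 : ℝ), φ x * Complex.exp (-s * (x : ℂ))

/-- `(ℒ|φ|)(s)` for real `s`, as an element of `[0, ∞]`. -/
def laplaceAbs (φ : ℝ → ℂ) (s : ℝ) : ℝ≥0∞ :=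
  ∫⁻ x in Ioi (0 : ℝ), ‖φ x‖ₑ * ENNReal.ofReal (Real.exp (-s * x))

/-- The domain `𝓕_f` of the L-series of a form `f` of weight `k` with Fourier coefficients
`c⁺(n)` (`n ≥ -n₀`) and `c⁻(n)`. -/
structure IsTestFunction (k : ℝ) (n₀ : ℕ) (cp : ℤ → ℂ) (cm : ℕ+ → ℂ) (φ : ℝ → ℂ) : Prop where
  continuousOn : ContinuousOn φ (Ioi 0)
  laplaceConvergent : ∀ s : ℂ, -2 * Real.pi * (n₀ : ℝ) ≤ s.re → LaplaceConvergent φ s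
  laplaceConvergent_twist : ∀ s : ℂ, 0 < s.re → LaplaceConvergent (twist φ (2 - (k : ℂ))) s
  series_convergent :
    (∑' n : Ici (-(n₀ : ℤ)), ‖cp n‖ₑ * laplaceAbs φ (2 * Real.pi * ((n : ℤ) : ℝ))) +
      (∑' n : ℕ+, ‖cm n‖ₑ * ENNReal.ofReal ((4 * Real.pi * (n : ℝ)) ^ (1 - k)) *
        ∫⁻ t in Ioi (0 : ℝ),
          laplaceAbs (twist φ (2 - (k : ℂ))) (2 * Real.pi * (n : ℝ) * (2 * t + 1)) /
            ENNReal.ofReal ((1 + t) ^ k)) < ⊤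

/-- The L-series `L_f(φ) = ∑_{n ≥ -n₀} c⁺(n) (ℒφ)(2πn)
+ ∑_{n > 0} c⁻(n) (4πn)^(1-k) ∫_0^∞ (ℒφ_{2-k})(2πn(2t+1)) (1+t)^(-k) dt`. -/
def Lvalue (k : ℝ) (n₀ : ℕ) (cp : ℤ → ℂ) (cm : ℕ+ → ℂ) (φ : ℝ → ℂ) : ℂ :=
  (∑' n : Ici (-(n₀ : ℤ)), cp n * laplace φ (2 * Real.pi * ((n : ℤ) : ℂ))) +
    ∑' n : ℕ+, cm n * (((4 * Real.pi * (n : ℝ)) ^ (1 - k) : ℝ) : ℂ) *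
      ∫ t in Ioi (0 : ℝ),
        laplace (twist φ (2 - (k : ℂ))) ((2 * Real.pi * (n : ℝ) * (2 * t + 1) : ℝ) : ℂ) /
          (((1 + t) ^ k : ℝ) : ℂ)

/-! ### The four integrands of the pre-summation formula -/

/-- `F(x) φ(x) e^(-2πnx) x⁻¹`. -/
def integrandCPlus (F φ : ℝ → ℂ) (n : ℤ) (x : ℝ) : ℂ :=
  F x * φ x * (Real.exp (-2 * Real.pi * (n : ℝ) * x) : ℂ) / (x : ℂ)

/-- `F(x) φ(x) e^(2πnx) Γ(1-k, 4πnx) x⁻¹`. -/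
def integrandCMinus (k : ℝ) (F φ : ℝ → ℂ) (n : ℕ+) (x : ℝ) : ℂ :=
  F x * φ x * (Real.exp (2 * Real.pi * (n : ℝ) * x) : ℂ) *
    (incGamma (1 - k) (4 * Real.pi * (n : ℝ) * x) : ℂ) / (x : ℂ)

/-- `F(x) φ(x) x^(-1-k) e^(-2πn/(Nx))`. -/
def integrandDPlus (N : ℕ) (k : ℝ) (F φ : ℝ → ℂ) (n : ℤ) (x : ℝ) : ℂ :=
  F x * φ x * ((x ^ (-1 - k) : ℝ) : ℂ) *
    (Real.exp (-(2 * Real.pi * (n : ℝ)) / ((N : ℝ) * x)) : ℂ)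

/-- `F(x) φ(x) x^(-1-k) e^(2πn/(Nx)) Γ(1-k, 4πn/(Nx))`. -/
def integrandDMinus (N : ℕ) (k : ℝ) (F φ : ℝ → ℂ) (n : ℕ+) (x : ℝ) : ℂ :=
  F x * φ x * ((x ^ (-1 - k) : ℝ) : ℂ) *
    (Real.exp (2 * Real.pi * (n : ℝ) / ((N : ℝ) * x)) : ℂ) *
    (incGamma (1 - k) (4 * Real.pi * (n : ℝ) / ((N : ℝ) * x)) : ℂ)

end HMF

end

/-! Both sides are the same integral over the imaginary axis, read off at the two cusps exchanged by
$w_N$. Mellin inversion on the line $\operatorname{Re} s=-1$ gives $|F(x)|\le Cx$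
(`exists_norm_le_mul_of_mellin`), so $|F\varphi/x|\le C|\varphi|$. The finiteness condition defining
$\mathcal F_f$, whose double integral is rewritten through $\Gamma(1-k,\cdot)$ by
`lintegral_laplaceAbs_twist_div`, is then exactly what dominated termwise integration needs: the
left side equals $\int_0^\infty F(x)\varphi(x)f(ix)\,dx/x$ (`summable_and_tsum_integrals_eq`).

The substitution $x=1/(Nu)$ turns this into an integral of the same shape, with $g=f|_kw_N$,
$\varphi|_{2-k}w_N$ and the kernel $N^2u^2F(1/(Nu))$ in place of $f,\varphi,F$
(`integral_imaginary_axis_eq`). The new kernel is again $O(u)$, so the same termwise integration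
applies to $g$, and undoing the substitution in each term gives the right side.

The finiteness condition says nothing about the $n$-th integral when the $n$-th coefficient
vanishes. Convergence of the single integrals is therefore proved apart: by the Laplace integrals at
$2\pi n$ for the plus terms, and for the minus terms by the moments $\int|\varphi|x^A\,dx$, finite
because every twist $\varphi_s$ is admissible. -/

noncomputable section

namespace HMF

/-! ### Growth of the kernel -/

/-- A continuous function with vertically integrable Mellin transform on `Re s = -1` is `O(x)`. -/
lemma exists_norm_le_mul_of_mellin {F : ℝ → ℂ} (hF : ContinuousOn F (Ioi 0))
    (hconv : MellinConvergent F (-1)) (hint : Complex.VerticalIntegrable (mellin F) (-1)) :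
    ∃ C : ℝ, 0 ≤ C ∧ ∀ x : ℝ, 0 < x → ‖F x‖ ≤ C * x := by
  refine ⟨|1 / (2 * Real.pi)| * ∫ y : ℝ, ‖mellin F (((-1 : ℝ) : ℂ) + y * Complex.I)‖,
    mul_nonneg (abs_nonneg _) (integral_nonneg fun _ => norm_nonneg _), fun x hx => ?_⟩
  have hinv := mellinInv_mellin_eq (-1) F hx (by simpa using hconv) hint
    (hF.continuousAt (Ioi_mem_nhds hx))
  rw [← hinv, mellinInv, norm_smul, Real.norm_eq_abs, mul_assoc]
  refine mul_le_mul_of_nonneg_left ?_ (abs_nonneg _)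
  refine (norm_integral_le_integral_norm _).trans_eq ?_
  rw [← integral_mul_const]
  refine integral_congr_ae (Eventually.of_forall fun y => ?_)
  have : ‖(x : ℂ) ^ (-(((-1 : ℝ) : ℂ) + y * Complex.I))‖ = x := by
    rw [Complex.norm_cpow_eq_rpow_re_of_pos hx]
    simp
  simp only [norm_smul, this]
  exact mul_comm _ _

/-! ### The incomplete Gamma function -/

/-- The exponent $a-1$ may be $\le -1$, but $0$ is excluded: for $t\ge u$ it can be raised to $|a|$
at the cost of a constant power of $u$, leaving a convergent Gamma integral over all of
$(0,\infty)$. -/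
lemma integrableOn_incGamma (a : ℝ) {u : ℝ} (hu : 0 < u) :
    IntegrableOn (fun t : ℝ => t ^ (a - 1) * Real.exp (-t)) (Ioi u) := by
  have h := integrableOn_rpow_mul_exp_neg_mul_rpow (p := 1) (s := |a|) (b := 1)
    (by linarith [abs_nonneg a]) one_pos one_pos
  refine Integrable.mono' ((h.mono_set (Ioi_subset_Ioi hu.le)).const_mul (u ^ (-(|a| - (a - 1)))))
    ?_ ?_
  · refine ContinuousOn.aestronglyMeasurable (fun t ht => ?_) measurableSet_Ioi
    have : t ≠ 0 := (hu.trans ht).ne'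
    fun_prop (disch := simp [this])
  · filter_upwards [ae_restrict_mem measurableSet_Ioi] with t ht
    have ht0 : 0 < t := hu.trans ht
    rw [Real.norm_of_nonneg (by positivity), Real.rpow_one, ← mul_assoc, neg_one_mul]
    gcongr
    calc t ^ (a - 1) = t ^ (-(|a| - (a - 1))) * t ^ |a| := by
          rw [← Real.rpow_add ht0]; congr 1; ring
      _ ≤ u ^ (-(|a| - (a - 1))) * t ^ |a| := by
          gcongr ?_ * _
          exact Real.rpow_le_rpow_of_nonpos hu (le_of_lt ht) (by linarith [le_abs_self a])

lemma incGamma_nonneg (a : ℝ) {u : ℝ} (hu : 0 < u) : 0 ≤ incGamma a u :=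
  setIntegral_nonneg measurableSet_Ioi fun t (ht : u < t) => by
    have := hu.trans ht
    positivity

/-- Monotonicity serves as the source of measurability of $x\mapsto\Gamma(1-k,4\pi nx)$. -/
lemma antitoneOn_incGamma (a : ℝ) : AntitoneOn (incGamma a) (Ioi 0) := by
  intro u (hu : 0 < u) v _ huv
  refine setIntegral_mono_set (integrableOn_incGamma a hu) ?_
    (LE.le.eventuallyLE (Ioi_subset_Ioi huv))
  filter_upwards [ae_restrict_mem measurableSet_Ioi] with t ht
  have : 0 < t := hu.trans ht
  positivity

/-- `Γ(a,u) e^(u/2)` is bounded by a power of `u`. -/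
lemma exists_incGamma_mul_exp_le (a : ℝ) :
    ∃ A C : ℝ, 0 ≤ C ∧ ∀ u : ℝ, 0 < u → incGamma a u * Real.exp (u / 2) ≤ C * u ^ A := by
  have hI := integrableOn_rpow_mul_exp_neg_mul_rpow (p := 1) (s := |a|) (b := 1 / 2)
    (by linarith [abs_nonneg a]) one_pos (by norm_num)
  have hnn : ∀ t ∈ Ioi (0 : ℝ), 0 ≤ t ^ |a| * Real.exp (-(1 / 2) * t ^ (1 : ℝ)) := by
    intro t (ht : 0 < t)
    positivity
  refine ⟨-(|a| - (a - 1)), ∫ t in Ioi (0 : ℝ), t ^ |a| * Real.exp (-(1 / 2) * t ^ (1 : ℝ)),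
    setIntegral_nonneg measurableSet_Ioi hnn, fun u hu => ?_⟩
  -- Half of the decay of $e^{-t}$ is spent on $e^{-u/2}$, using $t>u$; the other half keeps the
  -- remaining integral convergent uniformly in $u$.
  have key : incGamma a u ≤ (u ^ (-(|a| - (a - 1))) * Real.exp (-(u / 2))) *
      ∫ t in Ioi u, t ^ |a| * Real.exp (-(1 / 2) * t ^ (1 : ℝ)) := by
    rw [incGamma, ← integral_const_mul]
    refine setIntegral_mono_on (integrableOn_incGamma a hu)
      ((hI.mono_set (Ioi_subset_Ioi hu.le)).const_mul _) measurableSet_Ioi fun t (ht : u < t) => ?_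
    have ht0 : 0 < t := hu.trans ht
    have h1 : t ^ (a - 1) ≤ u ^ (-(|a| - (a - 1))) * t ^ |a| := by
      calc t ^ (a - 1) = t ^ (-(|a| - (a - 1))) * t ^ |a| := by
            rw [← Real.rpow_add ht0]; congr 1; ring
        _ ≤ u ^ (-(|a| - (a - 1))) * t ^ |a| := by
            gcongr ?_ * _
            exact Real.rpow_le_rpow_of_nonpos hu ht.le (by linarith [le_abs_self a])
    have h2 : Real.exp (-t) ≤ Real.exp (-(u / 2)) * Real.exp (-(1 / 2) * t ^ (1 : ℝ)) := by
      rw [← Real.exp_add, Real.rpow_one]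
      exact Real.exp_le_exp.2 (by linarith)
    calc _ ≤ (u ^ (-(|a| - (a - 1))) * t ^ |a|) *
          (Real.exp (-(u / 2)) * Real.exp (-(1 / 2) * t ^ (1 : ℝ))) := by gcongr
      _ = _ := by ring
  calc incGamma a u * Real.exp (u / 2)
      ≤ ((u ^ (-(|a| - (a - 1))) * Real.exp (-(u / 2))) *
        ∫ t in Ioi u, t ^ |a| * Real.exp (-(1 / 2) * t ^ (1 : ℝ))) * Real.exp (u / 2) := by gcongr
    _ = u ^ (-(|a| - (a - 1))) * ∫ t in Ioi u, t ^ |a| * Real.exp (-(1 / 2) * t ^ (1 : ℝ)) := by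
        rw [mul_right_comm, mul_assoc (u ^ _), ← Real.exp_add]; simp
    _ ≤ u ^ (-(|a| - (a - 1))) *
        ∫ t in Ioi (0 : ℝ), t ^ |a| * Real.exp (-(1 / 2) * t ^ (1 : ℝ)) := by
        refine mul_le_mul_of_nonneg_left ?_ (by positivity)
        refine setIntegral_mono_set hI ?_ (LE.le.eventuallyLE (Ioi_subset_Ioi hu.le))
        filter_upwards [ae_restrict_mem measurableSet_Ioi] with t ht using hnn t ht
    _ = _ := mul_comm _ _

/-- `∫_0^∞ e^(-ut) (1+t)^(a-1) dt = u^(-a) e^u Γ(a,u)`. -/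
lemma lintegral_exp_mul_rpow (a : ℝ) {u : ℝ} (hu : 0 < u) :
    ∫⁻ t in Ioi (0 : ℝ), ENNReal.ofReal (Real.exp (-u * t) * (1 + t) ^ (a - 1)) =
      ENNReal.ofReal (u ^ (-a) * Real.exp u * incGamma a u) := by
  -- The substitution is $t\mapsto u(1+t)$, with constant Jacobian $u$.
  have himg : (fun t : ℝ => u * (1 + t)) '' Ioi 0 = Ioi u := by
    ext y
    simp only [mem_image, mem_Ioi]
    constructor
    · rintro ⟨t, ht, rfl⟩
      nlinarith
    · intro hy
      refine ⟨y / u - 1, ?_, ?_⟩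
      · rw [sub_pos, one_lt_div hu]; exact hy
      · field_simp; ring
  have hinj : InjOn (fun t : ℝ => u * (1 + t)) (Ioi 0) := by
    intro x _ y _ h
    simpa [hu.ne'] using h
  have hder : ∀ x ∈ Ioi (0 : ℝ), HasDerivWithinAt (fun t : ℝ => u * (1 + t)) u (Ioi 0) x := by
    intro x _
    simpa using (((hasDerivAt_id x).const_add 1).const_mul u).hasDerivWithinAt
  have hnn : 0 ≤ᵐ[volume.restrict (Ioi u)] fun t : ℝ => t ^ (a - 1) * Real.exp (-t) := by
    filter_upwards [ae_restrict_mem measurableSet_Ioi] with t ht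
    have : 0 < t := hu.trans ht
    positivity
  rw [ENNReal.ofReal_mul (by positivity), incGamma,
    ofReal_integral_eq_lintegral_ofReal (integrableOn_incGamma a hu) hnn, ← himg,
    lintegral_image_eq_lintegral_abs_deriv_mul measurableSet_Ioi hder hinj,
    ← lintegral_const_mul' _ _ ENNReal.ofReal_ne_top]
  refine setLIntegral_congr_fun measurableSet_Ioi fun t (ht : 0 < t) => ?_
  rw [← ENNReal.ofReal_mul (by positivity), ← ENNReal.ofReal_mul (by positivity), abs_of_pos hu,
    Real.mul_rpow hu.le (by positivity)]
  congr 1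
  have h1 : u ^ (-a) * u * u ^ (a - 1) = 1 := by
    rw [← Real.rpow_add_one hu.ne', ← Real.rpow_add hu]; ring_nf; simp
  have h2 : Real.exp u * Real.exp (-(u * (1 + t))) = Real.exp (-u * t) := by
    rw [← Real.exp_add]; congr 1; ring
  calc _ = (u ^ (-a) * u * u ^ (a - 1)) * (Real.exp u * Real.exp (-(u * (1 + t)))) *
        (1 + t) ^ (a - 1) := by rw [h1, h2, one_mul]
    _ = _ := by ring

/-- The inner integral in the non-holomorphic part of the L-series, in terms of `Γ(1-k, ·)`. -/
lemma lintegral_laplaceAbs_twist_div {φ : ℝ → ℂ} (hφ : ContinuousOn φ (Ioi 0)) (k : ℝ) {ν : ℝ}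
    (hν : 0 < ν) :
    ∫⁻ t in Ioi (0 : ℝ), laplaceAbs (twist φ (2 - (k : ℂ))) (2 * Real.pi * ν * (2 * t + 1)) /
        ENNReal.ofReal ((1 + t) ^ k) =
      ENNReal.ofReal ((4 * Real.pi * ν) ^ (k - 1)) * ∫⁻ x in Ioi (0 : ℝ), ‖φ x‖ₑ *
        ENNReal.ofReal (Real.exp (2 * Real.pi * ν * x) * incGamma (1 - k) (4 * Real.pi * ν * x)) := by
  have hpi := Real.pi_pos
  have hm : AEMeasurable φ (volume.restrict (Ioi (0 : ℝ))) := hφ.aemeasurable measurableSet_Ioi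
  calc _ = ∫⁻ t in Ioi (0 : ℝ), ∫⁻ x in Ioi (0 : ℝ), ‖φ x‖ₑ * (ENNReal.ofReal (x ^ (1 - k) *
        Real.exp (-(2 * Real.pi * ν * (2 * t + 1)) * x) * (1 + t) ^ (-k))) := by
        refine setLIntegral_congr_fun measurableSet_Ioi fun t (ht : 0 < t) => ?_
        simp only [laplaceAbs]
        rw [ENNReal.div_eq_inv_mul, ← ENNReal.ofReal_inv_of_pos (by positivity),
          ← lintegral_const_mul' _ _ ENNReal.ofReal_ne_top]
        refine setLIntegral_congr_fun measurableSet_Ioi fun x (hx : 0 < x) => ?_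
        have : ‖(x : ℂ) ^ ((2 - (k : ℂ)) - 1)‖ₑ = ENNReal.ofReal (x ^ (1 - k)) := by
          rw [← ofReal_norm, Complex.norm_cpow_eq_rpow_re_of_pos hx]
          congr 2; simp; ring
        simp only [twist, enorm_mul, this]
        rw [Real.rpow_neg (by positivity), ENNReal.ofReal_mul (by positivity),
          ENNReal.ofReal_mul (by positivity)]
        ring
    _ = ∫⁻ x in Ioi (0 : ℝ), ∫⁻ t in Ioi (0 : ℝ), ‖φ x‖ₑ * (ENNReal.ofReal (x ^ (1 - k) *
        Real.exp (-(2 * Real.pi * ν * (2 * t + 1)) * x) * (1 + t) ^ (-k))) := by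
        refine lintegral_lintegral_swap ?_
        refine AEMeasurable.mul hm.enorm.comp_snd (Measurable.aemeasurable ?_)
        fun_prop
    _ = ∫⁻ x in Ioi (0 : ℝ), ENNReal.ofReal ((4 * Real.pi * ν) ^ (k - 1)) * (‖φ x‖ₑ *
        ENNReal.ofReal (Real.exp (2 * Real.pi * ν * x) *
          incGamma (1 - k) (4 * Real.pi * ν * x))) := by
        refine setLIntegral_congr_fun measurableSet_Ioi fun x (hx : 0 < x) => ?_
        have hu : 0 < 4 * Real.pi * ν * x := by positivity
        have hg := incGamma_nonneg (1 - k) hu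
        rw [lintegral_const_mul' _ _ enorm_ne_top, mul_left_comm]
        congr 1
        -- The exponent splits as $2\pi\nu x+(4\pi\nu x)t$, so the $t$-integral is the one for
        -- $\Gamma(1-k,u)$ at $u=4\pi\nu x$. Its factor $e^{u}$ turns $e^{-2\pi\nu x}$ into
        -- $e^{2\pi\nu x}$, and $u^{-(1-k)}$ cancels $x^{1-k}$.
        calc _ = ∫⁻ t in Ioi (0 : ℝ), ENNReal.ofReal (x ^ (1 - k) *
                Real.exp (-(2 * Real.pi * ν * x))) * ENNReal.ofReal
                (Real.exp (-(4 * Real.pi * ν * x) * t) * (1 + t) ^ ((1 - k) - 1)) := by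
              refine setLIntegral_congr_fun measurableSet_Ioi fun t (ht : 0 < t) => ?_
              rw [← ENNReal.ofReal_mul (by positivity)]
              congr 1
              have : Real.exp (-(2 * Real.pi * ν * (2 * t + 1)) * x) =
                  Real.exp (-(2 * Real.pi * ν * x)) * Real.exp (-(4 * Real.pi * ν * x) * t) := by
                rw [← Real.exp_add]; congr 1; ring
              rw [this, show 1 - k - 1 = -k by ring]
              ring
          _ = _ := by
              rw [lintegral_const_mul' _ _ ENNReal.ofReal_ne_top, lintegral_exp_mul_rpow _ hu,
                ← ENNReal.ofReal_mul (by positivity), ← ENNReal.ofReal_mul (by positivity)]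
              congr 1
              have h1 : Real.exp (-(2 * Real.pi * ν * x)) * Real.exp (4 * Real.pi * ν * x) =
                  Real.exp (2 * Real.pi * ν * x) := by
                rw [← Real.exp_add]; congr 1; ring
              have h2 : (4 * Real.pi * ν * x) ^ (-(1 - k)) * x ^ (1 - k) =
                  (4 * Real.pi * ν) ^ (k - 1) := by
                rw [Real.mul_rpow (by positivity) hx.le, mul_assoc, ← Real.rpow_add hx]
                simp
              rw [← h1, ← h2]
              ring
    _ = _ := lintegral_const_mul' _ _ ENNReal.ofReal_ne_top

/-! ### Termwise integration of the Fourier expansion -/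

/-- A pointwise convergent series with finite total `L¹` norm is integrable, and may be
integrated term by term. -/
lemma integrable_and_hasSum_integral_of_tsum_lintegral_ne_top {α ι : Type*} [MeasurableSpace α]
    {μ : Measure α} [Countable ι] {f : ι → α → ℂ} {g : α → ℂ}
    (hf : ∀ i, AEStronglyMeasurable (f i) μ) (hsum : ∑' i, ∫⁻ a, ‖f i a‖ₑ ∂μ ≠ ∞)
    (hg : ∀ᵐ a ∂μ, HasSum (fun i => f i a) (g a)) :
    Integrable g μ ∧ HasSum (fun i => ∫ a, f i a ∂μ) (∫ a, g a ∂μ) := by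
  have hgm : AEStronglyMeasurable g μ :=
    aestronglyMeasurable_of_tendsto_ae (u := (atTop : Filter (Finset ι)))
      (f := fun s a => ∑ i ∈ s, f i a)
      (fun s => Finset.aestronglyMeasurable_fun_sum s fun i _ => hf i) hg
  refine ⟨⟨hgm, ?_⟩, ?_⟩
  · rw [hasFiniteIntegral_iff_enorm]
    refine lt_of_le_of_lt ?_ hsum.lt_top
    rw [← lintegral_tsum fun i => (hf i).enorm]
    refine lintegral_mono_ae ?_
    filter_upwards [hg] with a ha
    rw [← ha.tsum_eq]
    exact enorm_tsum_le_tsum_enorm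
  · have heq : ∫ a, g a ∂μ = ∑' i, ∫ a, f i a ∂μ := by
      rw [← integral_tsum hf hsum]
      exact integral_congr_ae (hg.mono fun a ha => ha.tsum_eq.symm)
    rw [heq]
    refine Summable.hasSum (Summable.of_enorm (ne_top_of_le_ne_top hsum ?_))
    exact ENNReal.tsum_le_tsum fun i => enorm_integral_le_lintegral_enorm _

section Unfolding

variable {k : ℝ} {n₀ : ℕ} {cp : ℤ → ℂ} {cm : ℕ+ → ℂ} {φ F : ℝ → ℂ} {C : ℝ}

lemma norm_integrandCPlus_le (hFC : ∀ x : ℝ, 0 < x → ‖F x‖ ≤ C * x) (n : ℤ) {x : ℝ} (hx : 0 < x) :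
    ‖integrandCPlus F φ n x‖ ≤ C * (‖φ x‖ * Real.exp (-(2 * Real.pi * n) * x)) := by
  rw [integrandCPlus, norm_div, norm_mul, norm_mul, Complex.norm_of_nonneg (Real.exp_pos _).le,
    Complex.norm_of_nonneg hx.le, div_le_iff₀ hx,
    show -2 * Real.pi * n * x = -(2 * Real.pi * n) * x by ring]
  calc _ ≤ C * x * ‖φ x‖ * Real.exp (-(2 * Real.pi * n) * x) := by
        gcongr
        exact hFC x hx
    _ = _ := by ring

lemma norm_integrandCMinus_le (hFC : ∀ x : ℝ, 0 < x → ‖F x‖ ≤ C * x) (n : ℕ+) {x : ℝ}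
    (hx : 0 < x) :
    ‖integrandCMinus k F φ n x‖ ≤ C * (‖φ x‖ * (Real.exp (2 * Real.pi * n * x) *
      incGamma (1 - k) (4 * Real.pi * n * x))) := by
  have hg : 0 ≤ incGamma (1 - k) (4 * Real.pi * n * x) := by
    refine incGamma_nonneg _ ?_
    have : (0 : ℝ) < n := by exact_mod_cast n.pos
    positivity
  rw [integrandCMinus, norm_div, norm_mul, norm_mul, norm_mul,
    Complex.norm_of_nonneg (Real.exp_pos _).le, Complex.norm_of_nonneg hg,
    Complex.norm_of_nonneg hx.le, div_le_iff₀ hx]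
  calc _ ≤ C * x * ‖φ x‖ * Real.exp (2 * Real.pi * n * x) *
        incGamma (1 - k) (4 * Real.pi * n * x) := by
        gcongr
        exact hFC x hx
    _ = _ := by ring

lemma aestronglyMeasurable_integrandCPlus (hF : ContinuousOn F (Ioi 0))
    (hφ : ContinuousOn φ (Ioi 0)) (n : ℤ) :
    AEStronglyMeasurable (integrandCPlus F φ n) (volume.restrict (Ioi 0)) := by
  have h1 := hF.aemeasurable (μ := volume) measurableSet_Ioi
  have h2 := hφ.aemeasurable (μ := volume) measurableSet_Ioi
  refine AEMeasurable.aestronglyMeasurable ?_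
  unfold integrandCPlus
  fun_prop

lemma aestronglyMeasurable_integrandCMinus (hF : ContinuousOn F (Ioi 0))
    (hφ : ContinuousOn φ (Ioi 0)) (n : ℕ+) :
    AEStronglyMeasurable (integrandCMinus k F φ n) (volume.restrict (Ioi 0)) := by
  have h1 := hF.aemeasurable (μ := volume) measurableSet_Ioi
  have h2 := hφ.aemeasurable (μ := volume) measurableSet_Ioi
  have hn : 0 < 4 * Real.pi * (n : ℝ) := by
    have : (0 : ℝ) < n := by exact_mod_cast n.pos
    positivity
  have h3 : AEMeasurable (fun x : ℝ => incGamma (1 - k) (4 * Real.pi * (n : ℝ) * x))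
      (volume.restrict (Ioi 0)) := by
    refine aemeasurable_restrict_of_antitoneOn measurableSet_Ioi ?_
    intro x (hx : 0 < x) y (hy : 0 < y) hxy
    exact antitoneOn_incGamma _ (mul_pos hn hx) (mul_pos hn hy)
      (mul_le_mul_of_nonneg_left hxy hn.le)
  refine AEMeasurable.aestronglyMeasurable ?_
  unfold integrandCMinus
  fun_prop

/-- Since $|F|\le Cx$ absorbs the factor $1/x$, the Laplace integral of $\varphi$ at $2\pi n$
dominates, whether or not $c^+(n)$ vanishes; $n\ge-n_0$ places $2\pi n$ in the half-plane of
convergence. -/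
lemma integrableOn_integrandCPlus (hT : IsTestFunction k n₀ cp cm φ) (hF : ContinuousOn F (Ioi 0))
    (hFC : ∀ x : ℝ, 0 < x → ‖F x‖ ≤ C * x) (n : Ici (-(n₀ : ℤ))) :
    IntegrableOn (integrandCPlus F φ n) (Ioi 0) := by
  have hn : -(n₀ : ℝ) ≤ ((n : ℤ) : ℝ) := by exact_mod_cast n.2
  have h := hT.laplaceConvergent ((2 * Real.pi * ((n : ℤ) : ℝ) : ℝ) : ℂ) (by
    rw [Complex.ofReal_re]
    nlinarith [Real.pi_pos])
  refine Integrable.mono' (h.norm.const_mul C)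
    (aestronglyMeasurable_integrandCPlus hF hT.continuousOn n) ?_
  filter_upwards [ae_restrict_mem measurableSet_Ioi] with x hx
  refine (norm_integrandCPlus_le hFC n hx).trans_eq ?_
  rw [norm_mul, ← Complex.ofReal_neg, ← Complex.ofReal_mul, ← Complex.ofReal_exp,
    Complex.norm_of_nonneg (Real.exp_pos _).le]

/-- The growing factor $e^{2\pi nx}$ is $e^{u/2}$ for $u=4\pi nx$, and $e^{u/2}\Gamma(1-k,u)$ is at
most a power of $u$; a single moment of $\varphi$ therefore dominates. -/
lemma integrableOn_integrandCMinus (hC : 0 ≤ C) (hφ : ContinuousOn φ (Ioi 0))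
    (hint : ∀ A : ℝ, IntegrableOn (fun x : ℝ => ‖φ x‖ * x ^ A) (Ioi 0))
    (hF : ContinuousOn F (Ioi 0)) (hFC : ∀ x : ℝ, 0 < x → ‖F x‖ ≤ C * x) (n : ℕ+) :
    IntegrableOn (integrandCMinus k F φ n) (Ioi 0) := by
  have hn : (0 : ℝ) < n := by exact_mod_cast n.pos
  have hpi := Real.pi_pos
  obtain ⟨A, D, hD, hbound⟩ := exists_incGamma_mul_exp_le (1 - k)
  refine Integrable.mono' ((hint A).const_mul (C * (D * (4 * Real.pi * n) ^ A)))
    (aestronglyMeasurable_integrandCMinus hF hφ n) ?_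
  filter_upwards [ae_restrict_mem measurableSet_Ioi] with x hx
  have hx0 : 0 < x := hx
  refine (norm_integrandCMinus_le hFC n hx).trans ?_
  have h := hbound (4 * Real.pi * n * x) (by positivity)
  rw [Real.mul_rpow (by positivity) hx0.le,
    show 4 * Real.pi * n * x / 2 = 2 * Real.pi * n * x by ring, mul_comm (incGamma _ _)] at h
  calc _ ≤ C * (‖φ x‖ * (D * ((4 * Real.pi * n) ^ A * x ^ A))) := by gcongr
    _ = _ := by ring

lemma tsum_lintegral_integrandCPlus_ne_top (hT : IsTestFunction k n₀ cp cm φ)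
    (hFC : ∀ x : ℝ, 0 < x → ‖F x‖ ≤ C * x) :
    ∑' n : Ici (-(n₀ : ℤ)), ∫⁻ x in Ioi (0 : ℝ), ‖cp n * integrandCPlus F φ n x‖ₑ ≠ ∞ := by
  refine ne_top_of_le_ne_top (ENNReal.mul_ne_top (ENNReal.ofReal_ne_top (r := C))
    (ENNReal.add_lt_top.1 hT.series_convergent).1.ne) ?_
  rw [← ENNReal.tsum_mul_left]
  refine ENNReal.tsum_le_tsum fun n => ?_
  simp only [enorm_mul]
  rw [lintegral_const_mul' _ _ enorm_ne_top, mul_left_comm]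
  gcongr
  rw [laplaceAbs, ← lintegral_const_mul' _ _ ENNReal.ofReal_ne_top]
  refine setLIntegral_mono' measurableSet_Ioi fun x hx => ?_
  rw [← ofReal_norm (φ x), ← ofReal_norm, ← ENNReal.ofReal_mul (norm_nonneg _),
    ← ENNReal.ofReal_mul' (by positivity)]
  exact ENNReal.ofReal_le_ofReal (norm_integrandCPlus_le hFC n hx)

lemma tsum_lintegral_integrandCMinus_ne_top (hT : IsTestFunction k n₀ cp cm φ)
    (hFC : ∀ x : ℝ, 0 < x → ‖F x‖ ≤ C * x) :
    ∑' n : ℕ+, ∫⁻ x in Ioi (0 : ℝ), ‖cm n * integrandCMinus k F φ n x‖ₑ ≠ ∞ := by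
  refine ne_top_of_le_ne_top (ENNReal.mul_ne_top (ENNReal.ofReal_ne_top (r := C))
    (ENNReal.add_lt_top.1 hT.series_convergent).2.ne) ?_
  rw [← ENNReal.tsum_mul_left]
  refine ENNReal.tsum_le_tsum fun n => ?_
  have hn : (0 : ℝ) < n := by exact_mod_cast n.pos
  have hpi := Real.pi_pos
  simp only [enorm_mul]
  -- The normalising factor $(4\pi n)^{1-k}$ of the L-series is cancelled by the power produced when
  -- its inner integral is written through $\Gamma(1-k,\cdot)$.
  have hpow : ENNReal.ofReal ((4 * Real.pi * (n : ℝ)) ^ (1 - k)) *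
      ENNReal.ofReal ((4 * Real.pi * (n : ℝ)) ^ (k - 1)) = 1 := by
    rw [← ENNReal.ofReal_mul (by positivity), ← Real.rpow_add (by positivity)]
    simp
  rw [lintegral_const_mul' _ _ enorm_ne_top, lintegral_laplaceAbs_twist_div hT.continuousOn k hn,
    mul_assoc ‖cm n‖ₑ, mul_left_comm (ENNReal.ofReal C), ← mul_assoc (ENNReal.ofReal (_ ^ (1 - k))),
    hpow, one_mul]
  gcongr
  rw [← lintegral_const_mul' _ _ ENNReal.ofReal_ne_top]
  refine setLIntegral_mono' measurableSet_Ioi fun x (hx : 0 < x) => ?_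
  have hg : 0 ≤ incGamma (1 - k) (4 * Real.pi * n * x) := incGamma_nonneg _ (by positivity)
  rw [← ofReal_norm (φ x), ← ofReal_norm, ← ENNReal.ofReal_mul (norm_nonneg _),
    ← ENNReal.ofReal_mul' (by positivity)]
  exact ENNReal.ofReal_le_ofReal (norm_integrandCMinus_le hFC n hx)

/-- Termwise integration of the Fourier expansion of `f` on the imaginary axis. -/
lemma summable_and_tsum_integrals_eq {f : ℍ → ℂ} (hc : HasFourierExpansion k f n₀ cp cm)
    (hT : IsTestFunction k n₀ cp cm φ) (hF : ContinuousOn F (Ioi 0))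
    (hFC : ∀ x : ℝ, 0 < x → ‖F x‖ ≤ C * x) :
    Summable (fun n : Ici (-(n₀ : ℤ)) => cp n * ∫ x in Ioi (0 : ℝ), integrandCPlus F φ n x) ∧
    Summable (fun n : ℕ+ => cm n * ∫ x in Ioi (0 : ℝ), integrandCMinus k F φ n x) ∧
    (∑' n : Ici (-(n₀ : ℤ)), cp n * ∫ x in Ioi (0 : ℝ), integrandCPlus F φ n x) +
        (∑' n : ℕ+, cm n * ∫ x in Ioi (0 : ℝ), integrandCMinus k F φ n x) =
      ∫ x in Ioi (0 : ℝ), F x * φ x / x * f (UpperHalfPlane.ofComplex (Complex.I * x)) := by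
  -- `UpperHalfPlane.ofComplex` takes a default value off the upper half-plane, so positivity of $x$
  -- is essential here.
  have hz : ∀ x : ℝ, 0 < x →
      ((UpperHalfPlane.ofComplex (Complex.I * x) : ℍ) : ℂ) = Complex.I * x := fun x hx => by
    rw [UpperHalfPlane.ofComplex_apply_of_im_pos (by simpa using hx)]
  have him : ∀ x : ℝ, 0 < x → (UpperHalfPlane.ofComplex (Complex.I * x)).im = x := fun x hx => by
    rw [← UpperHalfPlane.coe_im, hz x hx]; simp
  obtain ⟨hi1, hs1⟩ := integrable_and_hasSum_integral_of_tsum_lintegral_ne_top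
    (μ := volume.restrict (Ioi (0 : ℝ)))
    (f := fun (n : Ici (-(n₀ : ℤ))) x => cp n * integrandCPlus F φ n x)
    (g := fun x => F x * φ x / x * ∑' n : Ici (-(n₀ : ℤ)), cp n * Complex.exp
      (2 * Real.pi * Complex.I * ((n : ℤ) : ℂ) * (UpperHalfPlane.ofComplex (Complex.I * x) : ℍ)))
    (fun n => (aestronglyMeasurable_integrandCPlus hF hT.continuousOn n).const_mul _)
    (tsum_lintegral_integrandCPlus_ne_top hT hFC) (by
      filter_upwards [ae_restrict_mem measurableSet_Ioi] with x hx
      refine ((hc (UpperHalfPlane.ofComplex (Complex.I * x))).1.hasSum.mul_left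
        (F x * φ x / x)).congr_fun fun n => ?_
      have : (2 * Real.pi * Complex.I * ((n : ℤ) : ℂ) * (Complex.I * x)) =
          ((-2 * Real.pi * ((n : ℤ) : ℝ) * x : ℝ) : ℂ) := by
        push_cast
        linear_combination (2 * Real.pi * ((n : ℤ) : ℂ) * x) * Complex.I_mul_I
      rw [hz x hx, this, ← Complex.ofReal_exp, integrandCPlus]
      ring)
  obtain ⟨hi2, hs2⟩ := integrable_and_hasSum_integral_of_tsum_lintegral_ne_top
    (μ := volume.restrict (Ioi (0 : ℝ)))
    (f := fun (n : ℕ+) x => cm n * integrandCMinus k F φ n x)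
    (g := fun x => F x * φ x / x * ∑' n : ℕ+, cm n * (incGamma (1 - k) (4 * Real.pi * (n : ℝ) *
        (UpperHalfPlane.ofComplex (Complex.I * x)).im) : ℂ) * Complex.exp
      (-(2 * Real.pi * Complex.I * ((n : ℕ) : ℂ) * (UpperHalfPlane.ofComplex (Complex.I * x) : ℍ))))
    (fun n => (aestronglyMeasurable_integrandCMinus hF hT.continuousOn n).const_mul _)
    (tsum_lintegral_integrandCMinus_ne_top hT hFC) (by
      filter_upwards [ae_restrict_mem measurableSet_Ioi] with x hx
      refine ((hc (UpperHalfPlane.ofComplex (Complex.I * x))).2.1.hasSum.mul_left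
        (F x * φ x / x)).congr_fun fun n => ?_
      have : -(2 * Real.pi * Complex.I * ((n : ℕ) : ℂ) * (Complex.I * x)) =
          ((2 * Real.pi * (n : ℝ) * x : ℝ) : ℂ) := by
        push_cast
        linear_combination (-(2 * Real.pi * ((n : ℕ) : ℂ) * x)) * Complex.I_mul_I
      rw [hz x hx, him x hx, this, ← Complex.ofReal_exp, integrandCMinus]
      ring)
  simp only [integral_const_mul] at hs1 hs2
  refine ⟨hs1.summable, hs2.summable, ?_⟩
  rw [hs1.tsum_eq, hs2.tsum_eq, ← integral_add hi1 hi2]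
  -- No restriction to $x>0$ is needed: the expansion holds at every point of $\mathbb H$, including
  -- the default value of `UpperHalfPlane.ofComplex`.
  refine integral_congr_ae (Eventually.of_forall fun x => ?_)
  simp only
  rw [(hc (UpperHalfPlane.ofComplex (Complex.I * x))).2.2, mul_add]

end Unfolding

/-! ### The involution `x ↦ 1/(Nx)` -/

section Inversion

variable {N : ℝ}

lemma image_one_div_mul_Ioi (hN : 0 < N) : (fun u : ℝ => 1 / (N * u)) '' Ioi 0 = Ioi 0 := by
  ext y
  simp only [mem_image, mem_Ioi]
  constructor
  · rintro ⟨u, hu, rfl⟩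
    positivity
  · intro hy
    exact ⟨1 / (N * y), by positivity, by field_simp⟩

lemma injOn_one_div_mul (hN : 0 < N) : InjOn (fun u : ℝ => 1 / (N * u)) (Ioi 0) := by
  intro x _ y _ h
  simpa [hN.ne'] using h

lemma hasDerivWithinAt_one_div_mul (hN : 0 < N) :
    ∀ x ∈ Ioi (0 : ℝ), HasDerivWithinAt (fun u : ℝ => 1 / (N * u)) (-(1 / (N * x ^ 2)))
      (Ioi 0) x := by
  intro x (hx : 0 < x)
  have h := ((hasDerivAt_inv hx.ne').const_mul N⁻¹).hasDerivWithinAt (s := Ioi 0)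
  refine (h.congr_deriv ?_).congr (fun u _ => ?_) ?_
  · field_simp
  · simp [mul_comm]
  · simp [mul_comm]

/-- The hypothesis says that `K` is the pullback of `H` with its Jacobian $1/(Nu^2)$, so that the
transformed integrand can be supplied in simplified form. -/
lemma integrableOn_Ioi_iff_one_div_mul (hN : 0 < N) {H K : ℝ → ℂ}
    (h : ∀ u : ℝ, 0 < u → ((1 / (N * u ^ 2) : ℝ) : ℂ) * H (1 / (N * u)) = K u) :
    IntegrableOn H (Ioi 0) ↔ IntegrableOn K (Ioi 0) := by
  have h1 := integrableOn_image_iff_integrableOn_abs_deriv_smul measurableSet_Ioi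
    (hasDerivWithinAt_one_div_mul hN) (injOn_one_div_mul hN) H
  rw [image_one_div_mul_Ioi hN] at h1
  rw [h1]
  refine integrableOn_congr_fun (fun u (hu : 0 < u) => ?_) measurableSet_Ioi
  rw [← h u hu, abs_neg, abs_of_pos (by positivity), Complex.real_smul]

lemma integral_Ioi_eq_one_div_mul (hN : 0 < N) {H K : ℝ → ℂ}
    (h : ∀ u : ℝ, 0 < u → ((1 / (N * u ^ 2) : ℝ) : ℂ) * H (1 / (N * u)) = K u) :
    ∫ x in Ioi (0 : ℝ), H x = ∫ u in Ioi (0 : ℝ), K u := by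
  have h1 := integral_image_eq_integral_abs_deriv_smul measurableSet_Ioi
    (hasDerivWithinAt_one_div_mul hN) (injOn_one_div_mul hN) H
  rw [image_one_div_mul_Ioi hN] at h1
  rw [h1]
  refine setIntegral_congr_fun measurableSet_Ioi (fun u (hu : 0 < u) => ?_)
  rw [← h u hu, abs_neg, abs_of_pos (by positivity), Complex.real_smul]

end Inversion

/-- The kernel `N²x² F(1/(Nx))`, which goes with `F` as `φ|_{2-k} w_N` goes with `φ`. -/
def dualKernel (N : ℕ) (F : ℝ → ℂ) : ℝ → ℂ := fun x =>
  ((((N : ℝ) * x) ^ 2 : ℝ) : ℂ) * F (1 / ((N : ℝ) * x))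

variable {N : ℕ} {k C : ℝ} {F φ : ℝ → ℂ}

lemma continuousOn_comp_one_div_mul (hN : 0 < N) (hF : ContinuousOn F (Ioi 0)) :
    ContinuousOn (fun x : ℝ => F (1 / ((N : ℝ) * x))) (Ioi 0) := by
  have hN' : (0 : ℝ) < N := by exact_mod_cast hN
  refine hF.comp (fun x (hx : 0 < x) => ?_) fun x (hx : 0 < x) => ?_
  · have : (N : ℝ) * x ≠ 0 := by positivity
    fun_prop (disch := exact this)
  · exact mem_Ioi.2 (by positivity)

lemma continuousOn_dualKernel (hN : 0 < N) (hF : ContinuousOn F (Ioi 0)) :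
    ContinuousOn (dualKernel N F) (Ioi 0) := by
  refine ContinuousOn.mul (Continuous.continuousOn ?_) (continuousOn_comp_one_div_mul hN hF)
  fun_prop

/-- The weight $(Nx)^2$ against $|F(1/(Nx))|\le C/(Nx)$ leaves a linear bound, the one hypothesis on
the size of the kernel that termwise integration needs. -/
lemma norm_dualKernel_le (hN : 0 < N) (hFC : ∀ x : ℝ, 0 < x → ‖F x‖ ≤ C * x) {x : ℝ} (hx : 0 < x) :
    ‖dualKernel N F x‖ ≤ C * N * x := by
  have hN' : (0 : ℝ) < N := by exact_mod_cast hN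
  rw [dualKernel, norm_mul, Complex.norm_of_nonneg (by positivity)]
  calc _ ≤ ((N : ℝ) * x) ^ 2 * (C * (1 / ((N : ℝ) * x))) := by
        gcongr
        exact hFC _ (by positivity)
    _ = _ := by field_simp

/-- The common factor of the `d`-integrands, transformed by `x = 1/(Nu)`. -/
lemma dual_factor_eq (hN : 0 < N) (F φ : ℝ → ℂ) (k : ℝ) {u : ℝ} (hu : 0 < u) :
    ((1 / ((N : ℝ) * u ^ 2) : ℝ) : ℂ) * (F (1 / (N * u)) * φ (1 / (N * u)) *
      (((1 / (N * u) : ℝ) ^ (-1 - k) : ℝ) : ℂ)) =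
      dualKernel N F u * testFricke N (2 - k) φ u / u := by
  have hN' : (0 : ℝ) < N := by exact_mod_cast hN
  have hNu : 0 < (N : ℝ) * u := by positivity
  -- Of the three powers of $Nu$, two go into the dual kernel, and the third with the Jacobian
  -- $1/(Nu^2)$ leaves $1/u$.
  have h1 : (1 / (N * u) : ℝ) ^ (-1 - k) = (N * u) ^ 3 * (N * u) ^ (-(2 - k)) := by
    rw [one_div, Real.inv_rpow hNu.le, ← Real.rpow_neg hNu.le, ← Real.rpow_natCast,
      ← Real.rpow_add hNu]
    congr 1; push_cast; ring
  have hu' : (u : ℂ) ≠ 0 := by exact_mod_cast hu.ne'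
  have hNc : (N : ℂ) ≠ 0 := by exact_mod_cast hN.ne'
  rw [h1, dualKernel, testFricke]
  push_cast
  field_simp

lemma integrandDPlus_one_div (hN : 0 < N) (F φ : ℝ → ℂ) (k : ℝ) (n : ℤ) {u : ℝ} (hu : 0 < u) :
    ((1 / ((N : ℝ) * u ^ 2) : ℝ) : ℂ) * integrandDPlus N k F φ n (1 / (N * u)) =
      integrandCPlus (dualKernel N F) (testFricke N (2 - k) φ) n u := by
  have hN' : (0 : ℝ) < N := by exact_mod_cast hN
  rw [integrandDPlus, integrandCPlus, ← mul_assoc, dual_factor_eq hN F φ k hu,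
    show -(2 * Real.pi * (n : ℝ)) / (N * (1 / (N * u))) = -2 * Real.pi * n * u by field_simp]
  ring

lemma integrandDMinus_one_div (hN : 0 < N) (F φ : ℝ → ℂ) (k : ℝ) (n : ℕ+) {u : ℝ} (hu : 0 < u) :
    ((1 / ((N : ℝ) * u ^ 2) : ℝ) : ℂ) * integrandDMinus N k F φ n (1 / (N * u)) =
      integrandCMinus k (dualKernel N F) (testFricke N (2 - k) φ) n u := by
  have hN' : (0 : ℝ) < N := by exact_mod_cast hN
  rw [integrandDMinus, integrandCMinus, ← mul_assoc, ← mul_assoc, dual_factor_eq hN F φ k hu,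
    show 2 * Real.pi * (n : ℝ) / (N * (1 / (N * u))) = 2 * Real.pi * n * u by field_simp,
    show 4 * Real.pi * (n : ℝ) / (N * (1 / (N * u))) = 4 * Real.pi * n * u by field_simp]
  ring

/-- The values of `f|_k w_N` on the imaginary axis. -/
lemma fricke_ofComplex_I_mul (hN : 0 < N) (k : ℝ) (f : ℍ → ℂ) {u : ℝ} (hu : 0 < u) :
    Complex.I ^ (k : ℂ) * (N : ℂ) ^ (-(k : ℂ) / 2) *
      fricke N k f (UpperHalfPlane.ofComplex (Complex.I * u)) =
      ((((N : ℝ) * u) ^ (-k) : ℝ) : ℂ) *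
        f (UpperHalfPlane.ofComplex (Complex.I * ((1 / (N * u) : ℝ) : ℂ))) := by
  have hN' : (0 : ℝ) < N := by exact_mod_cast hN
  have hNc : (N : ℂ) ≠ 0 := by exact_mod_cast hN.ne'
  have hu' : (u : ℂ) ≠ 0 := by exact_mod_cast hu.ne'
  have hNu : 0 < (N : ℝ) * u := by positivity
  rw [fricke, UpperHalfPlane.ofComplex_apply_of_im_pos (by simpa using hu)]
  have h1 : (-1 : ℂ) / (N * (Complex.I * u)) = Complex.I * ((1 / (N * u) : ℝ) : ℂ) := by
    push_cast
    field_simp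
    simp
  -- The principal power is multiplicative here because $Nu$ is a positive real: $\log(Nu\cdot
  -- i)=\log(Nu)+\log i$. The factor $i^{-k}$ is what $i^k$ in the formula compensates.
  have h2 : ((N : ℂ) * (Complex.I * u)) ^ (-(k : ℂ)) =
      ((((N : ℝ) * u) ^ (-k) : ℝ) : ℂ) * Complex.I ^ (-(k : ℂ)) := by
    rw [Complex.ofReal_cpow hNu.le, show (N : ℂ) * (Complex.I * u) = (((N : ℝ) * u : ℝ) : ℂ) *
      Complex.I by push_cast; ring]
    rw [Complex.cpow_def_of_ne_zero (mul_ne_zero (by exact_mod_cast hNu.ne') Complex.I_ne_zero),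
      Complex.cpow_def_of_ne_zero (by exact_mod_cast hNu.ne'),
      Complex.cpow_def_of_ne_zero Complex.I_ne_zero,
      Complex.log_ofReal_mul hNu Complex.I_ne_zero, Complex.ofReal_log hNu.le, ← Complex.exp_add]
    push_cast
    ring_nf
  have h3 : (N : ℂ) ^ (-(k : ℂ) / 2) * (N : ℂ) ^ ((k : ℂ) / 2) = 1 := by
    rw [← Complex.cpow_add _ _ hNc]
    ring_nf
    simp
  have h4 : Complex.I ^ (k : ℂ) * Complex.I ^ (-(k : ℂ)) = 1 := by
    rw [← Complex.cpow_add _ _ Complex.I_ne_zero]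
    simp
  simp only [h1, h2]
  linear_combination (((((N : ℝ) * u) ^ (-k) : ℝ) : ℂ) *
        f (UpperHalfPlane.ofComplex (Complex.I * ((1 / (N * u) : ℝ) : ℂ)))) *
    (Complex.I ^ (k : ℂ) * Complex.I ^ (-(k : ℂ)) * h3 + h4)

/-- The map $x=1/(Nu)$ is the action of $w_N$ on the imaginary axis, so the identity is the
definition of $f|_kw_N$ combined with a change of variables. -/
lemma integral_imaginary_axis_eq (hN : 0 < N) (k : ℝ) (F φ : ℝ → ℂ) (f : ℍ → ℂ) :
    ∫ x in Ioi (0 : ℝ), F x * φ x / x * f (UpperHalfPlane.ofComplex (Complex.I * x)) =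
      Complex.I ^ (k : ℂ) * (N : ℂ) ^ (-(k : ℂ) / 2) *
        ∫ u in Ioi (0 : ℝ), dualKernel N F u * testFricke N (2 - k) φ u / u *
          fricke N k f (UpperHalfPlane.ofComplex (Complex.I * u)) := by
  have hN' : (0 : ℝ) < N := by exact_mod_cast hN
  rw [← integral_const_mul]
  refine integral_Ioi_eq_one_div_mul hN' fun u hu => ?_
  have hNu : 0 < (N : ℝ) * u := by positivity
  rw [mul_left_comm (Complex.I ^ _ * _), fricke_ofComplex_I_mul hN k f hu, ← dual_factor_eq hN F φ k hu]
  -- With $x=1/(Nu)$ this reads $x^{-1-k}\cdot x^{k}=x^{-1}$: the weight $x^{-1-k}$ on the $g$ side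
  -- is $1/x$ times the inverse of the automorphy factor.
  have h : (((1 / (N * u) : ℝ) ^ (-1 - k) : ℝ) : ℂ) * ((((N : ℝ) * u) ^ (-k) : ℝ) : ℂ) =
      (((1 / (N * u) : ℝ) : ℂ))⁻¹ := by
    rw [← Complex.ofReal_mul, ← Complex.ofReal_inv, one_div, Real.inv_rpow hNu.le,
      ← Real.rpow_neg hNu.le, ← Real.rpow_add hNu, inv_inv]
    congr 1
    ring_nf
    simp
  rw [div_eq_mul_inv (F _ * φ _), ← h]
  ring

/-! ### Moments of the test functions -/

lemma twist_one (φ : ℝ → ℂ) : twist φ 1 = φ := by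
  ext x
  simp [twist]

/-- The moment of order $A$ is the absolute Laplace integral at $0$ of the twist with $s=A+1$. -/
lemma integrableOn_norm_mul_rpow
    (h : ∀ s : ℂ, LaplaceConvergent (twist φ s) 0) (A : ℝ) :
    IntegrableOn (fun x : ℝ => ‖φ x‖ * x ^ A) (Ioi 0) := by
  refine (integrableOn_congr_fun (fun x (hx : 0 < x) => ?_) measurableSet_Ioi).1 (h (A + 1)).norm
  simp [twist, Complex.norm_cpow_eq_rpow_re_of_pos hx]

/-- Under $x\mapsto 1/(Nx)$ the twist contributes $(Nx)^{1-s}$, so order $A$ corresponds to $s=1-A$.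
-/
lemma integrableOn_norm_testFricke_mul_rpow (hN : 0 < N)
    (h : ∀ s : ℂ, LaplaceConvergent (testFricke N (2 - k) (twist φ s)) 0) (A : ℝ) :
    IntegrableOn (fun x : ℝ => ‖testFricke N (2 - k) φ x‖ * x ^ A) (Ioi 0) := by
  have hN' : (0 : ℝ) < N := by exact_mod_cast hN
  refine (integrableOn_congr_fun (fun x (hx : 0 < x) => ?_) measurableSet_Ioi).1
    ((h (1 - A)).norm.const_mul (((N : ℝ) ^ A)⁻¹))
  have hNx : 0 < (N : ℝ) * x := by positivity
  have h1 : ‖((1 / ((N : ℝ) * x) : ℝ) : ℂ) ^ ((1 - (A : ℂ)) - 1)‖ = (N : ℝ) ^ A * x ^ A := by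
    rw [Complex.norm_cpow_eq_rpow_re_of_pos (by positivity), one_div, Real.inv_rpow hNx.le,
      ← Real.rpow_neg hNx.le, ← Real.mul_rpow hN'.le hx.le]
    simp
  have hNA : 0 < (N : ℝ) ^ A := by positivity
  simp only [testFricke, twist, norm_mul, h1]
  simp only [neg_zero, zero_mul, Complex.exp_zero, norm_one, mul_one]
  field_simp

end HMF

end

/-! ### The pre-summation formula -/

theorem mainTheorem6
    (N : ℕ) (hN : 0 < N)
    (k : ℝ) (hk : ∃ m : ℤ, k = (m : ℝ) / 2) (hkN : (¬ ∃ m : ℤ, k = m) → 4 ∣ N)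
    (χ : DirichletCharacter ℂ N)
    (f : UpperHalfPlane → ℂ) (hf : HMF.IsHarmonicMaassForm N k χ f)
    -- `c⁺, c⁻` are the coefficients of `f`, and `d⁺, d⁻` those of `g = f|_k w_N`
    (n₀ m₀ : ℕ) (cp dp : ℤ → ℂ) (cm dm : ℕ+ → ℂ)
    (hc : HMF.HasFourierExpansion k f n₀ cp cm)
    (hd : HMF.HasFourierExpansion k (HMF.fricke N k f) m₀ dp dm)
    -- the kernel `F`
    (F : ℝ → ℂ) (hF : ContinuousOn F (Set.Ioi 0))
    (hFconv : ∀ s : ℂ, s.re < 0 → MellinConvergent F s)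
    (hFint : ∀ ε : ℝ, 0 < ε → Complex.VerticalIntegrable (mellin F) (-ε))
    -- the test function `φ`
    (φ : ℝ → ℂ) (hφ : ContinuousOn φ (Set.Ioi 0))
    (hφf : ∀ s : ℂ, HMF.IsTestFunction k n₀ cp cm (HMF.twist φ s))
    (hφg : ∀ s : ℂ, HMF.IsTestFunction k m₀ dp dm (HMF.testFricke N (2 - k) (HMF.twist φ s)))
    (hLf : Differentiable ℂ fun s : ℂ => HMF.Lvalue k n₀ cp cm (HMF.twist φ s))
    (hLg : Differentiable ℂ fun s : ℂ =>
      HMF.Lvalue k m₀ dp dm (HMF.testFricke N (2 - k) (HMF.twist φ s))) :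
    -- all integrals converge absolutely
    (∀ n : Set.Ici (-(n₀ : ℤ)),
      MeasureTheory.IntegrableOn (HMF.integrandCPlus F φ n) (Set.Ioi 0)) ∧
    (∀ n : ℕ+, MeasureTheory.IntegrableOn (HMF.integrandCMinus k F φ n) (Set.Ioi 0)) ∧
    (∀ n : Set.Ici (-(m₀ : ℤ)),
      MeasureTheory.IntegrableOn (HMF.integrandDPlus N k F φ n) (Set.Ioi 0)) ∧
    (∀ n : ℕ+, MeasureTheory.IntegrableOn (HMF.integrandDMinus N k F φ n) (Set.Ioi 0)) ∧
    -- all series converge absolutely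
    Summable (fun n : Set.Ici (-(n₀ : ℤ)) =>
      cp n * ∫ x in Set.Ioi (0 : ℝ), HMF.integrandCPlus F φ n x) ∧
    Summable (fun n : ℕ+ => cm n * ∫ x in Set.Ioi (0 : ℝ), HMF.integrandCMinus k F φ n x) ∧
    Summable (fun n : Set.Ici (-(m₀ : ℤ)) =>
      dp n * ∫ x in Set.Ioi (0 : ℝ), HMF.integrandDPlus N k F φ n x) ∧
    Summable (fun n : ℕ+ => dm n * ∫ x in Set.Ioi (0 : ℝ), HMF.integrandDMinus N k F φ n x) ∧
    -- the pre-summation formula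
    (∑' n : Set.Ici (-(n₀ : ℤ)), cp n * ∫ x in Set.Ioi (0 : ℝ), HMF.integrandCPlus F φ n x) +
        (∑' n : ℕ+, cm n * ∫ x in Set.Ioi (0 : ℝ), HMF.integrandCMinus k F φ n x) =
      Complex.I ^ (k : ℂ) * (N : ℂ) ^ (-(k : ℂ) / 2) *
        ((∑' n : Set.Ici (-(m₀ : ℤ)),
            dp n * ∫ x in Set.Ioi (0 : ℝ), HMF.integrandDPlus N k F φ n x) +
          ∑' n : ℕ+, dm n * ∫ x in Set.Ioi (0 : ℝ), HMF.integrandDMinus N k F φ n x) := by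
  have hN' : (0 : ℝ) < N := by exact_mod_cast hN
  -- The line $\operatorname{Re}s=-1$ is chosen so that the resulting bound $Cx$ cancels the factor
  -- $1/x$ of the measure.
  obtain ⟨C, hC, hFC⟩ := HMF.exists_norm_le_mul_of_mellin hF (hFconv (-1) (by simp))
    (hFint 1 one_pos)
  have hTf := hφf 1
  have hTg := hφg 1
  rw [HMF.twist_one] at hTf hTg
  have hzero (m : ℕ) : -2 * Real.pi * (m : ℝ) ≤ (0 : ℂ).re := by
    have : 0 ≤ Real.pi * m := by positivity
    rw [Complex.zero_re]
    linarith
  have hG := HMF.continuousOn_dualKernel hN hF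
  have hGC : ∀ x : ℝ, 0 < x → ‖HMF.dualKernel N F x‖ ≤ C * N * x :=
    fun x hx => HMF.norm_dualKernel_le hN hFC hx
  have hp (n : ℤ) := fun u hu => HMF.integrandDPlus_one_div hN F φ k n (u := u) hu
  have hm (n : ℕ+) := fun u hu => HMF.integrandDMinus_one_div hN F φ k n (u := u) hu
  obtain ⟨hcs1, hcs2, hceq⟩ := HMF.summable_and_tsum_integrals_eq hc hTf hF hFC
  obtain ⟨hds1, hds2, hdeq⟩ := HMF.summable_and_tsum_integrals_eq hd hTg hG hGC
  -- Each $d$-integral becomes a $c$-type integral for the dual kernel and $\varphi|_{2-k}w_N$, so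
  -- the termwise integration for $g$ applies verbatim.
  simp only [fun n => HMF.integral_Ioi_eq_one_div_mul hN' (hp n),
    fun n => HMF.integral_Ioi_eq_one_div_mul hN' (hm n)]
  refine ⟨fun n => HMF.integrableOn_integrandCPlus hTf hF hFC n,
    fun n => HMF.integrableOn_integrandCMinus hC hTf.continuousOn
      (HMF.integrableOn_norm_mul_rpow fun s => (hφf s).laplaceConvergent 0 (hzero _)) hF hFC n,
    fun n => (HMF.integrableOn_Ioi_iff_one_div_mul hN' (hp n)).2
      (HMF.integrableOn_integrandCPlus hTg hG hGC n),
    fun n => (HMF.integrableOn_Ioi_iff_one_div_mul hN' (hm n)).2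
      (HMF.integrableOn_integrandCMinus (by positivity) hTg.continuousOn
        (HMF.integrableOn_norm_testFricke_mul_rpow hN fun s =>
          (hφg s).laplaceConvergent 0 (hzero _)) hG hGC n),
    hcs1, hcs2, hds1, hds2, ?_⟩
  rw [hceq, hdeq, HMF.integral_imaginary_axis_eq hN]
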